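/- **Conventions.** A signature $\Sigma$ is a finite set of function symbols with arities. Terms are built from countably many names, countably many variables and the symbols of $\Sigma$. $\Sigma$ is equipped with an equational theory, presented by a set of equations between terms without names; $\Sigma\vdash M=N$ denotes the least congruence on terms containing all substitution instances of these equations. The *word problem* in $\Sigma$ is: given terms $M,N$, does $\Sigma\vdash M=N$ hold? *Processes* are those of the applied pi calculus. Plain processes: $P::=0\mid\overline M\langle N\rangle.P\mid M(x).P\mid\nu n.P\mid \mathrm{if}\ M=N\ \mathrm{then}\ P\ \mathrm{else}\ Q\mid P+Q\mid P|Q\mid\,!P$; extended processes: $A::=P\mid\nu n.A\mid\nu x.A\mid A|B\mid\{M/x\}$, where active substitutions are cycle-free, parallel components have disjoint domains, and $\nu x$ is applied only to $x\in\mathrm{dom}(A)$. $A$ is closed if $\mathrm{fv}(A)=\mathrm{dom}(A)$, and name-variable-distinct if no name (variable) is both free and restricted and none is restricted twice. Structural equivalence $\equiv$, internal reduction $\to$, labelled transitions $\xrightarrow{M(N)}$ and $\xrightarrow{\nu x.\overline M\langle x\rangle}$, and the weak transitions $\overset{\mu}{\Longrightarrow}$ (with $\mu$ silent or a label) are the usual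 ones. For a frame $\varphi$, $(M=N)\varphi$ means that $\mathrm v(M)\cup\mathrm v(N)\subseteq\mathrm{dom}(\varphi)$ and that there are names $\tilde n$ not occurring in $M,N$ and an active substitution $\sigma$ with $\varphi\equiv\nu\tilde n.\sigma$ and $\Sigma\vdash M\sigma=N\sigma$. Closed processes are statically equivalent, $A\approx_s B$, if their frames have the same domain and satisfy the same equalities $(M=N)$. A *trace* of $A_0$ is a finite sequence $\mathbf{tr}=A_0\overset{\mu_1}{\Longrightarrow}\cdots\overset{\mu_n}{\Longrightarrow}A_n$ of closed extended processes with $\mathrm{fv}(\mu_i)\subseteq\mathrm{dom}(A_{i-1})$; $|\mathbf{tr}|=n$, $\mathbf{tr}[i]=A_i$, and $\mathbf{tr}[0,i]$ is its initial part up to $A_i$. $\mathbf{tr}\sim_t\mathbf{tr}'$ means equal lengths, equal actions, and $\mathbf{tr}[i]\approx_s\mathbf{tr}'[i]$ for all $i$. *Formulas*: static formulas $\delta::=\top\mid M_1=M_2\mid M\in\mathrm{dom}\mid\delta\lor\delta\mid\lnot\delta$ and modal formulas $\varphi::=\delta\mid\varphi\lor\varphi\mid\lnot\varphi\mid\langle\mu\rangle_-\varphi\mid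 F\varphi\mid K\varphi$. Let $A$ be a name-variable-distinct extended process, $\tilde x=\mathrm{fv}(A)\setminus\mathrm{dom}(A)$, $\rho$ an assignment of ground terms to $\tilde x$, $\mathbf{tr}$ a trace of $A\rho$ and $0\le i\le|\mathbf{tr}|$. Satisfaction $A,\rho,\mathbf{tr},i\models\varphi$ is defined by: $M_1=M_2$ holds iff $(M_1\rho=M_2\rho)$ in the frame of $\mathbf{tr}[i]$; $M\in\mathrm{dom}$ holds iff $M$ is a variable in $\mathrm{dom}(\mathbf{tr}[i])$; $\top,\lor,\lnot$ are as usual; $\langle\mu\rangle_-\varphi$ holds iff $i\ge1$, $\mu_i=\mu$ and $A,\rho,\mathbf{tr},i-1\models\varphi$; $F\varphi$ holds iff $A,\rho,\mathbf{tr},j\models\varphi$ for some $i\le j\le|\mathbf{tr}|$; $K\varphi$ holds iff $A,\rho',\mathbf{tr}',i\models\varphi$ for every assignment $\rho'$ of ground terms to $\tilde x$ and every trace $\mathbf{tr}'$ of $A\rho'$ with $i\le|\mathbf{tr}'|$ and $\mathbf{tr}[0,i]\sim_t\mathbf{tr}'[0,i]$. The *satisfaction problem* over $\Sigma$ is: given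 a name-variable-distinct extended process $A$, an assignment $\rho$ of ground terms to $\mathrm{fv}(A)\setminus\mathrm{dom}(A)$, a trace $\mathbf{tr}$ of $A\rho$ through name-variable-distinct processes (given as its list of processes and actions), an index $0\le i\le|\mathbf{tr}|$, and a formula $\varphi$ with free variables in $(\mathrm{fv}(A)\setminus\mathrm{dom}(A))\cup\mathrm{dom}(\mathbf{tr}[i])$, does $A,\rho,\mathbf{tr},i\models\varphi$ hold? **Proposition.** There exist a signature $\Sigma$ and an equational theory on it such that the word problem in $\Sigma$ is decidable, but the satisfaction problem over $\Sigma$ is undecidable: no partial recursive function halts with the correct answer on (the standard Gödel code of) every admissible input. -/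

import Mathlib

namespace AppliedPi

/-! ## Signatures, terms, equational theories -/

/-- A signature: finitely many function symbols, each with an arity. -/
structure Signature where
  numSymbols : ℕ
  arity : Fin numSymbols → ℕ

/-- Terms over a signature. Names and variables are two disjoint countably infinite sorts,
each indexed by the natural numbers. -/
inductive Term (S : Signature) : Type
  | name (n : ℕ) : Term S
  | var (x : ℕ) : Term S
  | app (f : Fin S.numSymbols) (args : Fin (S.arity f) → Term S) : Term S

namespace Term

variable {S : Signature}

/-- The names `n(M)` of a term. -/
def names : Term S → Finset ℕ
  | name n => {n}
  | var _ => ∅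
  | app _ args => Finset.univ.biUnion fun i => (args i).names

/-- The variables `v(M)` of a term. -/
def vars : Term S → Finset ℕ
  | name _ => ∅
  | var x => {x}
  | app _ args => Finset.univ.biUnion fun i => (args i).vars

/-- A term is ground when it contains no variables. -/
def IsGround (M : Term S) : Prop := M.vars = ∅

/-- Simultaneous renaming of names by `a` and substitution of terms for variables by `s`. -/
def subst (a : ℕ → ℕ) (s : ℕ → Term S) : Term S → Term S
  | name n => name (a n)
  | var x => s x
  | app f args => app f fun i => (args i).subst a s

/-- Gödel number of a term. -/
def code : Term S → ℕ
  | name n => Nat.pair 0 n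
  | var x => Nat.pair 1 x
  | app f args => Nat.pair 2 (Nat.pair f (Encodable.encode (List.ofFn fun i => (args i).code)))

end Term

/-- An equational theory is presented by a set of equations between terms without names. -/
structure Theory (S : Signature) where
  eqs : Set (Term S × Term S)
  nameless : ∀ e ∈ eqs, e.1.names = ∅ ∧ e.2.names = ∅

/-- `T.Eq M N` is `Σ ⊢ M = N`: the least congruence on terms that contains all substitution
instances of the equations of `T`. -/
inductive Theory.Eq {S : Signature} (T : Theory S) : Term S → Term S → Prop
  | inst {M N : Term S} (s : ℕ → Term S) (h : (M, N) ∈ T.eqs) :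
      Theory.Eq T (M.subst id s) (N.subst id s)
  | refl (M : Term S) : Theory.Eq T M M
  | symm {M N : Term S} : Theory.Eq T M N → Theory.Eq T N M
  | trans {M N L : Term S} : Theory.Eq T M N → Theory.Eq T N L → Theory.Eq T M L
  | congr (f : Fin S.numSymbols) {as bs : Fin (S.arity f) → Term S}
      (h : ∀ i, Theory.Eq T (as i) (bs i)) : Theory.Eq T (Term.app f as) (Term.app f bs)

/-- A finite map from variables to terms, as an association list; variables that are not listed
are left unchanged. -/
abbrev Subst (S : Signature) := List (ℕ × Term S)

/-- The map from variables to terms that an association list denotes. -/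
def Subst.toFun {S : Signature} (s : Subst S) (x : ℕ) : Term S :=
  (s.lookup x).getD (Term.var x)

/-! ## Processes -/

/-- Raw processes. Plain and extended processes are carved out below by `IsPlain` and `WF`. -/
inductive Proc (S : Signature) : Type
  | nil : Proc S
  | out (M N : Term S) (P : Proc S) : Proc S
  | inp (M : Term S) (x : ℕ) (P : Proc S) : Proc S
  | nuName (n : ℕ) (A : Proc S) : Proc S
  | cond (M N : Term S) (P Q : Proc S) : Proc S
  | sum (P Q : Proc S) : Proc S
  | par (A B : Proc S) : Proc S
  | repl (P : Proc S) : Proc S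
  | nuVar (x : ℕ) (A : Proc S) : Proc S
  | asub (M : Term S) (x : ℕ) : Proc S

/-- `x` itself when it is not in `s`, otherwise a number outside `s`. -/
def freshFor (x : ℕ) (s : Finset ℕ) : ℕ := if x ∈ s then s.sup id + 1 else x

namespace Proc

variable {S : Signature}

/-- Free names. -/
def fn : Proc S → Finset ℕ
  | nil => ∅
  | out M N P => M.names ∪ N.names ∪ P.fn
  | inp M _ P => M.names ∪ P.fn
  | nuName n A => A.fn.erase n
  | cond M N P Q => M.names ∪ N.names ∪ P.fn ∪ Q.fn
  | sum P Q => P.fn ∪ Q.fn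
  | par A B => A.fn ∪ B.fn
  | repl P => P.fn
  | nuVar _ A => A.fn
  | asub M _ => M.names

/-- Free variables. -/
def fv : Proc S → Finset ℕ
  | nil => ∅
  | out M N P => M.vars ∪ N.vars ∪ P.fv
  | inp M x P => M.vars ∪ P.fv.erase x
  | nuName _ A => A.fv
  | cond M N P Q => M.vars ∪ N.vars ∪ P.fv ∪ Q.fv
  | sum P Q => P.fv ∪ Q.fv
  | par A B => A.fv ∪ B.fv
  | repl P => P.fv
  | nuVar x A => A.fv.erase x
  | asub M x => insert x M.vars

/-- Bound (restricted) names, listed with multiplicity. -/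
def bn : Proc S → List ℕ
  | nil => []
  | out _ _ P => P.bn
  | inp _ _ P => P.bn
  | nuName n A => n :: A.bn
  | cond _ _ P Q => P.bn ++ Q.bn
  | sum P Q => P.bn ++ Q.bn
  | par A B => A.bn ++ B.bn
  | repl P => P.bn
  | nuVar _ A => A.bn
  | asub _ _ => []

/-- Restricted variables, listed with multiplicity. Plain processes have none. -/
def rv : Proc S → List ℕ
  | nuName _ A => A.rv
  | par A B => A.rv ++ B.rv
  | nuVar x A => x :: A.rv
  | _ => []

/-- The domain of an extended process. -/
def dom : Proc S → Finset ℕ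
  | nuName _ A => A.dom
  | par A B => A.dom ∪ B.dom
  | nuVar x A => A.dom.erase x
  | asub _ x => {x}
  | _ => ∅

/-- Plain processes: no variable restriction and no active substitution. -/
def IsPlain : Proc S → Prop
  | nil => True
  | out _ _ P => P.IsPlain
  | inp _ _ P => P.IsPlain
  | nuName _ P => P.IsPlain
  | cond _ _ P Q => P.IsPlain ∧ Q.IsPlain
  | sum P Q => P.IsPlain ∧ Q.IsPlain
  | par P Q => P.IsPlain ∧ Q.IsPlain
  | repl P => P.IsPlain
  | nuVar _ _ => False
  | asub _ _ => False

/-- `A.Dep x y`: the active substitution of `A` for its free variable `x` refers to the free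
variable `y`, possibly by way of restricted variables. -/
def Dep : Proc S → ℕ → ℕ → Prop
  | nuName _ A, y, z => A.Dep y z
  | par A B, y, z => A.Dep y z ∨ B.Dep y z
  | nuVar x A, y, z => y ≠ x ∧ z ≠ x ∧ Relation.TransGen A.Dep y z
  | asub M x, y, z => y = x ∧ z ∈ M.vars
  | _, _, _ => False

/-- Extended processes: the grammar, together with the three standing restrictions that
parallel components have disjoint domains, that only variables of the domain are restricted, and
that active substitutions are cycle-free. -/
def WF : Proc S → Prop
  | nil => True
  | out _ _ P => P.IsPlain
  | inp _ _ P => P.IsPlain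
  | nuName _ A => A.WF
  | cond _ _ P Q => P.IsPlain ∧ Q.IsPlain
  | sum P Q => P.IsPlain ∧ Q.IsPlain
  | par A B => A.WF ∧ B.WF ∧ Disjoint A.dom B.dom ∧
      ∀ x, ¬ Relation.TransGen (fun y z => A.Dep y z ∨ B.Dep y z) x x
  | repl P => P.IsPlain
  | nuVar x A => A.WF ∧ x ∈ A.dom
  | asub M x => x ∉ M.vars

/-- `A` is closed when its free variables are exactly its domain. -/
def IsClosed (A : Proc S) : Prop := A.fv = A.dom

/-- Name-variable-distinct processes: no name is both free and bound, no name is restricted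
twice, and likewise for variables. -/
def Distinct (A : Proc S) : Prop :=
  (∀ n ∈ A.bn, n ∉ A.fn) ∧ A.bn.Nodup ∧ (∀ x ∈ A.rv, x ∉ A.fv) ∧ A.rv.Nodup

/-- Capture-avoiding simultaneous renaming of free names by `a` and substitution of terms for
free variables by `s`. A binder is kept unless it would capture something. The variable `x` of an
active substitution `{M/x}` is only ever renamed (when `s x` is a variable). -/
def subst : Proc S → (ℕ → ℕ) → (ℕ → Term S) → Proc S
  | nil, _, _ => nil
  | out M N P, a, s => out (M.subst a s) (N.subst a s) (P.subst a s)
  | inp M x P, a, s =>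
      let y := freshFor x ((P.fv.erase x).biUnion fun z => (s z).vars)
      inp (M.subst a s) y (P.subst a (Function.update s x (Term.var y)))
  | nuName n A, a, s =>
      let m := freshFor n ((A.fn.erase n).image a ∪ A.fv.biUnion fun z => (s z).names)
      nuName m (A.subst (Function.update a n m) s)
  | cond M N P Q, a, s => cond (M.subst a s) (N.subst a s) (P.subst a s) (Q.subst a s)
  | sum P Q, a, s => sum (P.subst a s) (Q.subst a s)
  | par A B, a, s => par (A.subst a s) (B.subst a s)
  | repl P, a, s => repl (P.subst a s)
  | nuVar x A, a, s =>
      let y := freshFor x ((A.fv.erase x).biUnion fun z => (s z).vars)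
      nuVar y (A.subst a (Function.update s x (Term.var y)))
  | asub M x, a, s =>
      asub (M.subst a s) (match s x with
        | Term.var y => y
        | _ => x)

/-- `A{M/x}`. -/
def substVar (A : Proc S) (x : ℕ) (M : Term S) : Proc S :=
  A.subst id (Function.update Term.var x M)

/-- `A{m/n}` for names `m` and `n`. -/
def renameName (A : Proc S) (n m : ℕ) : Proc S :=
  A.subst (Function.update id n m) Term.var

/-- `Aρ`. -/
def assign (A : Proc S) (ρ : Subst S) : Proc S := A.subst id ρ.toFun

/-- The frame of an extended process. -/
def frame : Proc S → Proc S
  | nuName n A => nuName n A.frame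
  | nuVar x A => nuVar x A.frame
  | par A B => par A.frame B.frame
  | asub M x => asub M x
  | _ => nil

/-- The active substitution `{M₁/x₁} | ... | {Mₖ/xₖ}`. -/
def ofSubst (s : Subst S) : Proc S := s.foldr (fun p A => par (asub p.2 p.1) A) nil

/-- `ν n₁. ... ν nₖ. A`. -/
def nuNames (ns : List ℕ) (A : Proc S) : Proc S := ns.foldr nuName A

/-- Gödel number of a process. -/
def code : Proc S → ℕ
  | nil => Nat.pair 0 0
  | out M N P => Nat.pair 1 (Nat.pair M.code (Nat.pair N.code P.code))
  | inp M x P => Nat.pair 2 (Nat.pair M.code (Nat.pair x P.code))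
  | nuName n A => Nat.pair 3 (Nat.pair n A.code)
  | cond M N P Q => Nat.pair 4 (Nat.pair M.code (Nat.pair N.code (Nat.pair P.code Q.code)))
  | sum P Q => Nat.pair 5 (Nat.pair P.code Q.code)
  | par A B => Nat.pair 6 (Nat.pair A.code B.code)
  | repl P => Nat.pair 7 P.code
  | nuVar x A => Nat.pair 8 (Nat.pair x A.code)
  | asub M x => Nat.pair 9 (Nat.pair M.code x)

end Proc

open Proc

/-! ## Semantics of processes -/

section Semantics

variable {S : Signature}

/-- `α`-equivalence, for bound names, input variables and restricted variables. -/
inductive AlphaEq : Proc S → Proc S → Prop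
  | refl (A) : AlphaEq A A
  | symm {A B} : AlphaEq A B → AlphaEq B A
  | trans {A B C} : AlphaEq A B → AlphaEq B C → AlphaEq A C
  | nuName_conv (n m A) (h : m ∉ A.fn) : AlphaEq (nuName n A) (nuName m (A.renameName n m))
  | nuVar_conv (x y A) (h : y ∉ A.fv) :
      AlphaEq (nuVar x A) (nuVar y (A.substVar x (Term.var y)))
  | inp_conv (M x y P) (h : y ∉ P.fv) :
      AlphaEq (inp M x P) (inp M y (P.substVar x (Term.var y)))
  | out (M N) {P P'} : AlphaEq P P' → AlphaEq (out M N P) (out M N P')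
  | inp (M x) {P P'} : AlphaEq P P' → AlphaEq (inp M x P) (inp M x P')
  | nuName (n) {A A'} : AlphaEq A A' → AlphaEq (nuName n A) (nuName n A')
  | cond (M N) {P P' Q Q'} :
      AlphaEq P P' → AlphaEq Q Q' → AlphaEq (cond M N P Q) (cond M N P' Q')
  | sum {P P' Q Q'} : AlphaEq P P' → AlphaEq Q Q' → AlphaEq (sum P Q) (sum P' Q')
  | par {A A' B B'} : AlphaEq A A' → AlphaEq B B' → AlphaEq (par A B) (par A' B')
  | repl {P P'} : AlphaEq P P' → AlphaEq (repl P) (repl P')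
  | nuVar (x) {A A'} : AlphaEq A A' → AlphaEq (nuVar x A) (nuVar x A')

/-- One-hole contexts whose hole is not under a replication, a conditional or a prefix. -/
inductive EvalCtx (S : Signature) : Type
  | hole : EvalCtx S
  | nuName (n : ℕ) (E : EvalCtx S) : EvalCtx S
  | nuVar (x : ℕ) (E : EvalCtx S) : EvalCtx S
  | parL (E : EvalCtx S) (B : Proc S) : EvalCtx S
  | parR (A : Proc S) (E : EvalCtx S) : EvalCtx S
  | sumL (E : EvalCtx S) (Q : Proc S) : EvalCtx S
  | sumR (P : Proc S) (E : EvalCtx S) : EvalCtx S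

/-- `E[A]`. -/
def EvalCtx.fill : EvalCtx S → Proc S → Proc S
  | hole, A => A
  | nuName n E, A => Proc.nuName n (E.fill A)
  | nuVar x E, A => Proc.nuVar x (E.fill A)
  | parL E B, A => Proc.par (E.fill A) B
  | parR B E, A => Proc.par B (E.fill A)
  | sumL E Q, A => Proc.sum (E.fill A) Q
  | sumR P E, A => Proc.sum P (E.fill A)

/-- The defining rules of structural equivalence. -/
inductive StructRule (T : Theory S) : Proc S → Proc S → Prop
  | par_nil (A) : StructRule T (par A nil) A
  | par_assoc (A B C) : StructRule T (par (par A B) C) (par A (par B C))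
  | par_comm (A B) : StructRule T (par A B) (par B A)
  | extrude_name (n A B) (h : n ∉ B.fn) :
      StructRule T (par (nuName n A) B) (nuName n (par A B))
  | extrude_var (x A B) (h : x ∉ B.fv) :
      StructRule T (par (nuVar x A) B) (nuVar x (par A B))
  | swap_names (m n A) : StructRule T (nuName m (nuName n A)) (nuName n (nuName m A))
  | swap_name_var (n x A) : StructRule T (nuName n (nuVar x A)) (nuVar x (nuName n A))
  | swap_vars (x y A) : StructRule T (nuVar x (nuVar y A)) (nuVar y (nuVar x A))
  | repl (P) : StructRule T (repl P) (par P (repl P))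
  | sum_comm (P Q) : StructRule T (sum P Q) (sum Q P)
  | hide (M x) : StructRule T (nuVar x (asub M x)) nil
  | apply_sub (A M x) : StructRule T (par A (asub M x)) (par (A.substVar x M) (asub M x))
  | rewrite (M N x) (h : T.Eq M N) : StructRule T (asub M x) (asub N x)

/-- Structural equivalence: the least equivalence relation on extended processes that contains
the rules and `α`-conversion and is closed under evaluation contexts. -/
inductive StructEq (T : Theory S) : Proc S → Proc S → Prop
  | refl {A} (hA : A.WF) : StructEq T A A
  | symm {A B} : StructEq T A B → StructEq T B A
  | trans {A B C} : StructEq T A B → StructEq T B C → StructEq T A C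
  | rule {A B} (hA : A.WF) (hB : B.WF) : StructRule T A B → StructEq T A B
  | alpha {A B} (hA : A.WF) (hB : B.WF) : AlphaEq A B → StructEq T A B
  | ctx (E : EvalCtx S) {A B} (hA : (E.fill A).WF) (hB : (E.fill B).WF) :
      StructEq T A B → StructEq T (E.fill A) (E.fill B)

/-- Internal reduction `A → B` of extended processes. -/
inductive Red (T : Theory S) : Proc S → Proc S → Prop
  | then_ {M N P Q} (hW : (cond M N P Q).WF) (h : T.Eq M N) : Red T (cond M N P Q) P
  | else_ {M N P Q} (hW : (cond M N P Q).WF) (hM : M.IsGround) (hN : N.IsGround)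
      (h : ¬ T.Eq M N) : Red T (cond M N P Q) Q
  | choice {P Q} (hW : (sum P Q).WF) : Red T (sum P Q) P
  | comm {M N x P Q} (hW : (par (out M N P) (inp M x Q)).WF) :
      Red T (par (out M N P) (inp M x Q)) (par P (Q.substVar x N))
  | struct {A A' B' B} : StructEq T A A' → Red T A' B' → StructEq T B' B → Red T A B
  | ctx (E : EvalCtx S) {A B} (hA : (E.fill A).WF) (hB : (E.fill B).WF) :
      Red T A B → Red T (E.fill A) (E.fill B)

/-- Labels: input `M(N)` and output `ν x. M̄⟨x⟩`. -/
inductive Label (S : Signature) : Type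
  | inp (M N : Term S) : Label S
  | out (x : ℕ) (M : Term S) : Label S

namespace Label

/-- Names of a label. -/
def names : Label S → Finset ℕ
  | inp M N => M.names ∪ N.names
  | out _ M => M.names

/-- Free variables of a label. -/
def fv : Label S → Finset ℕ
  | inp M N => M.vars ∪ N.vars
  | out _ M => M.vars

/-- Restricted variables of a label. -/
def rv : Label S → Finset ℕ
  | inp _ _ => ∅
  | out x _ => {x}

end Label

/-- Labelled transitions of extended processes. -/
inductive LStep (T : Theory S) : Proc S → Label S → Proc S → Prop
  | inp {M x P} (N : Term S) (hW : (inp M x P).WF) :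
      LStep T (inp M x P) (Label.inp M N) (P.substVar x N)
  | out {M N P} (x : ℕ) (hW : (out M N P).WF) (hx : x ∉ (out M N P).fv) :
      LStep T (out M N P) (Label.out x M) (par P (asub N x))
  | nuName {n A α A'} (hn : n ∉ α.names) :
      LStep T A α A' → LStep T (nuName n A) α (nuName n A')
  | nuVar {x A α A'} (hW : (nuVar x A).WF) (hW' : (nuVar x A').WF) (hx : x ∉ α.fv ∪ α.rv) :
      LStep T A α A' → LStep T (nuVar x A) α (nuVar x A')
  | par {A α A' B} (hW : (par A B).WF) (hW' : (par A' B).WF) (hB : Disjoint α.rv B.fv) :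
      LStep T A α A' → LStep T (par A B) α (par A' B)
  | struct {A A' α B' B} :
      StructEq T A A' → LStep T A' α B' → StructEq T B' B → LStep T A α B

/-- Actions: `none` is the silent action. -/
abbrev Action (S : Signature) := Option (Label S)

/-- Free variables of an action. -/
def Action.fv : Action S → Finset ℕ
  | none => ∅
  | some α => Label.fv α

/-- `A ⟹ B` under an action. -/
def WeakStep (T : Theory S) (A : Proc S) : Action S → Proc S → Prop
  | none, B => Relation.ReflTransGen (Red T) A B
  | some α, B => ∃ A' B', Relation.ReflTransGen (Red T) A A' ∧ LStep T A' α B' ∧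
      Relation.ReflTransGen (Red T) B' B

/-- `(M = N)φ` for a frame `φ`. -/
def EqIn (T : Theory S) (φ : Proc S) (M N : Term S) : Prop :=
  M.vars ∪ N.vars ⊆ φ.dom ∧
    ∃ (ns : List ℕ) (s : Subst S), StructEq T φ (nuNames ns (ofSubst s)) ∧
      (∀ n ∈ ns, n ∉ M.names ∪ N.names) ∧
      T.Eq (M.subst id s.toFun) (N.subst id s.toFun)

/-- Static equivalence of (closed) extended processes: static equivalence of their frames. -/
def StaticEq (T : Theory S) (A B : Proc S) : Prop :=
  A.frame.dom = B.frame.dom ∧ ∀ M N : Term S, EqIn T A.frame M N ↔ EqIn T B.frame M N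

end Semantics

/-! ## Traces -/

/-- A sequence `A₀ ⟹ A₁ ⟹ ... ⟹ Aₙ` of processes with an action on every arrow;
`IsTrace` says that the arrows are transitions. -/
structure Trace (S : Signature) where
  start : Proc S
  steps : List (Action S × Proc S)

namespace Trace

variable {S : Signature}

/-- The length `|tr|`. -/
def length (tr : Trace S) : ℕ := tr.steps.length

/-- The `i`-th process `tr[i]`, for `i ≤ |tr|`. -/
def proc (tr : Trace S) (i : ℕ) : Proc S := (tr.start :: tr.steps.map Prod.snd).getD i Proc.nil

/-- The initial part `tr[0,i]`. -/
def upTo (tr : Trace S) (i : ℕ) : Trace S := ⟨tr.start, tr.steps.take i⟩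

end Trace

section Traces

variable {S : Signature}

/-- Traces from a given process: every process is a closed extended process and the free
variables of every action lie in the domain of the process it starts from. -/
def IsTraceFrom (T : Theory S) : Proc S → List (Action S × Proc S) → Prop
  | A, [] => A.WF ∧ A.IsClosed
  | A, (μ, B) :: l =>
      A.WF ∧ A.IsClosed ∧ Action.fv μ ⊆ A.dom ∧ WeakStep T A μ B ∧ IsTraceFrom T B l

/-- `tr ∈ tr(A)`. -/
def IsTrace (T : Theory S) (A : Proc S) (tr : Trace S) : Prop :=
  tr.start = A ∧ IsTraceFrom T tr.start tr.steps

/-- Static equivalence `tr ∼ₜ tr'` of traces. -/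
def TraceEq (T : Theory S) (tr tr' : Trace S) : Prop :=
  tr.length = tr'.length ∧ tr.steps.map Prod.fst = tr'.steps.map Prod.fst ∧
    ∀ i ≤ tr.length, StaticEq T (tr.proc i) (tr'.proc i)

end Traces

/-! ## The epistemic logic -/

/-- Formulas. The static formulas are those built from `top`, `eq`, `inDom`, `or`, `neg`;
`past μ φ` is `⟨μ⟩₋ φ`, `ev φ` is `F φ`, `know φ` is `K φ`. -/
inductive Formula (S : Signature) : Type
  | top : Formula S
  | eq (M N : Term S) : Formula S
  | inDom (M : Term S) : Formula S
  | or (φ ψ : Formula S) : Formula S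
  | neg (φ : Formula S) : Formula S
  | past (μ : Action S) (φ : Formula S) : Formula S
  | ev (φ : Formula S) : Formula S
  | know (φ : Formula S) : Formula S

section Logic

variable {S : Signature}

/-- Free variables of a formula. -/
def Formula.fv : Formula S → Finset ℕ
  | top => ∅
  | eq M N => M.vars ∪ N.vars
  | inDom M => M.vars
  | or φ ψ => φ.fv ∪ ψ.fv
  | neg φ => φ.fv
  | past μ φ => Action.fv μ ∪ φ.fv
  | ev φ => φ.fv
  | know φ => φ.fv

/-- `ρ` is an assignment for `A`: a map from `fv(A) \ dom(A)` to ground terms. -/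
def IsAssignment (A : Proc S) (ρ : Subst S) : Prop :=
  (ρ.map Prod.fst).Nodup ∧ (ρ.map Prod.fst).toFinset = A.fv \ A.dom ∧ ∀ p ∈ ρ, p.2.IsGround

/-- Satisfaction `A, ρ, tr, i ⊨ φ`. -/
def Sat (T : Theory S) (A : Proc S) : Formula S → Subst S → Trace S → ℕ → Prop
  | .top, _, _, _ => True
  | .eq M N, ρ, tr, i =>
      EqIn T (tr.proc i).frame (M.subst id ρ.toFun) (N.subst id ρ.toFun)
  | .inDom M, _, tr, i => ∃ x, M = Term.var x ∧ x ∈ (tr.proc i).dom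
  | .or φ ψ, ρ, tr, i => Sat T A φ ρ tr i ∨ Sat T A ψ ρ tr i
  | .neg φ, ρ, tr, i => ¬ Sat T A φ ρ tr i
  | .past μ φ, ρ, tr, i =>
      ∃ j, i = j + 1 ∧ (tr.steps.map Prod.fst)[j]? = some μ ∧ Sat T A φ ρ tr j
  | .ev φ, ρ, tr, i => ∃ j, i ≤ j ∧ j ≤ tr.length ∧ Sat T A φ ρ tr j
  | .know φ, _, tr, i => ∀ (ρ' : Subst S) (tr' : Trace S), IsAssignment A ρ' →
      IsTrace T (A.assign ρ') tr' → i ≤ tr'.length → TraceEq T (tr.upTo i) (tr'.upTo i) →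
      Sat T A φ ρ' tr' i

end Logic

/-! ## Decision problems -/

/-- Gödel number of a label. -/
def Label.code {S : Signature} : Label S → ℕ
  | inp M N => Nat.pair 0 (Nat.pair M.code N.code)
  | out x M => Nat.pair 1 (Nat.pair x M.code)

/-- Gödel number of an action. -/
def Action.code {S : Signature} : Action S → ℕ
  | none => 0
  | some α => Label.code α + 1

/-- Gödel number of a formula. -/
def Formula.code {S : Signature} : Formula S → ℕ
  | top => Nat.pair 0 0
  | eq M N => Nat.pair 1 (Nat.pair M.code N.code)
  | inDom M => Nat.pair 2 M.code
  | or φ ψ => Nat.pair 3 (Nat.pair φ.code ψ.code)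
  | neg φ => Nat.pair 4 φ.code
  | past μ φ => Nat.pair 5 (Nat.pair (Action.code μ) φ.code)
  | ev φ => Nat.pair 6 φ.code
  | know φ => Nat.pair 7 φ.code

theorem Term.code_injective {S : Signature} : Function.Injective (Term.code (S := S)) := by
  intro M
  induction M with
  | name n => intro N h; cases N <;> simp_all [Term.code, Nat.pair_eq_pair]
  | var n => intro N h; cases N <;> simp_all [Term.code, Nat.pair_eq_pair]
  | app f as ih =>
    intro N h
    cases N with
    | name n => simp [Term.code, Nat.pair_eq_pair] at h
    | var n => simp [Term.code, Nat.pair_eq_pair] at h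
    | app g bs =>
      simp only [Term.code, Nat.pair_eq_pair, true_and, Fin.val_inj] at h
      obtain ⟨rfl, h⟩ := h
      have h' := List.ofFn_injective (Encodable.encode_injective h)
      congr 1
      funext i
      exact ih i (congrFun h' i)

theorem Proc.code_injective {S : Signature} : Function.Injective (Proc.code (S := S)) := by
  intro A
  induction A <;> intro B h <;> cases B <;>
    simp_all [Proc.code, Nat.pair_eq_pair, Term.code_injective.eq_iff] <;> grind

theorem Action.code_injective {S : Signature} : Function.Injective (Action.code (S := S)) := by
  intro μ ν h
  rcases μ with _ | ⟨_⟩ | ⟨_⟩ <;> rcases ν with _ | ⟨_⟩ | ⟨_⟩ <;>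
    simp_all [Action.code, Label.code, Nat.pair_eq_pair, Term.code_injective.eq_iff]

theorem Formula.code_injective {S : Signature} :
    Function.Injective (Formula.code (S := S)) := by
  intro φ
  induction φ <;> intro ψ h <;> cases ψ <;>
    simp_all [Formula.code, Nat.pair_eq_pair, Term.code_injective.eq_iff,
      Action.code_injective.eq_iff] <;> grind

/-- A decision problem (inputs `a` with `valid a`, question `p a`, inputs presented to algorithms
through `code`) is decidable when some partial recursive function halts on the code of every valid
input with the right answer. Nothing is asked of it on other codes. -/
def DecidableProblem {α γ : Type} [Primcodable γ] (code : α → γ) (valid p : α → Prop) : Prop :=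
  ∃ f : γ →. Bool, Partrec f ∧ ∀ a, valid a → ∃ b ∈ f (code a), (b = true ↔ p a)

/-- The word problem: given terms `M` and `N`, does `Σ ⊢ M = N` hold? -/
def Theory.WordProblemDecidable {S : Signature} (T : Theory S) : Prop :=
  DecidableProblem (fun p : Term S × Term S => (p.1.code, p.2.code)) (fun _ => True)
    (fun p => T.Eq p.1 p.2)

/-- Raw inputs of the satisfaction problem. -/
structure SatInput (S : Signature) where
  proc : Proc S
  asg : Subst S
  trace : Trace S
  idx : ℕ
  formula : Formula S

namespace SatInput

variable {S : Signature}

/-- Inputs of the satisfaction problem: a name-variable-distinct extended process `A`, an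
assignment `ρ` for `A`, a trace `tr` of `Aρ` through name-variable-distinct processes, an index
`i ≤ |tr|`, and a formula whose free variables are in `(fv(A) \ dom(A)) ∪ dom(tr[i])`. -/
def Valid (T : Theory S) (I : SatInput S) : Prop :=
  I.proc.WF ∧ I.proc.Distinct ∧ IsAssignment I.proc I.asg ∧
    IsTrace T (I.proc.assign I.asg) I.trace ∧
    (∀ j ≤ I.trace.length, (I.trace.proc j).Distinct) ∧
    I.idx ≤ I.trace.length ∧
    I.formula.fv ⊆ (I.proc.fv \ I.proc.dom) ∪ (I.trace.proc I.idx).dom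

/-- Finite presentation of an input by natural numbers and lists of natural numbers. -/
def code (I : SatInput S) : ℕ × List (ℕ × ℕ) × ℕ × List (ℕ × ℕ) × ℕ × ℕ :=
  (I.proc.code, I.asg.map fun p => (p.1, p.2.code), I.trace.start.code,
    I.trace.steps.map fun q => (Action.code q.1, q.2.code), I.idx, I.formula.code)

end SatInput

theorem SatInput.code_injective {S : Signature} :
    Function.Injective (SatInput.code (S := S)) := by
  rintro ⟨A, ρ, ⟨B, l⟩, i, φ⟩ ⟨A', ρ', ⟨B', l'⟩, i', φ'⟩ h
  simp only [SatInput.code, Prod.mk.injEq] at h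
  obtain ⟨h1, h2, h3, h4, h5, h6⟩ := h
  have e2 : ρ = ρ' := List.map_injective_iff.2 (fun p q hpq => by
    simp only [Prod.mk.injEq, Term.code_injective.eq_iff] at hpq
    exact Prod.ext hpq.1 hpq.2) h2
  have e4 : l = l' := List.map_injective_iff.2 (fun p q hpq => by
    simp only [Prod.mk.injEq, Proc.code_injective.eq_iff, Action.code_injective.eq_iff] at hpq
    exact Prod.ext hpq.1 hpq.2) h4
  rw [Proc.code_injective h1, e2, Proc.code_injective h3, e4, h5, Formula.code_injective h6]

/-- The satisfaction problem: given `A`, `ρ`, `tr`, `i` and `φ`, does `A, ρ, tr, i ⊨ φ` hold? -/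
def Theory.SatDecidable {S : Signature} (T : Theory S) : Prop :=
  DecidableProblem SatInput.code (SatInput.Valid T)
    (fun I => Sat T I.proc I.formula I.asg I.trace I.idx)

end AppliedPi

namespace AppliedPi

open Proc

/-! ## Ground terms -/

/-! Checking a given witness can be easy while deciding whether a witness exists is impossible; `K`
turns the first question into the second. In `haltTheory` a numeral `k` solves `run e k = zero`
exactly when it bounds a halting computation of program `e`.

The word problem is decidable because the equations are ground, their left-hand sides are recognised
by a primitive recursive test, and innermost contraction yields a complete invariant of equality
(`haltTheory_eq_iff`). Carried out on Gödel numbers by course-of-values recursion, this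
normalisation is primitive recursive (`normalCode_code`, `primrec_normalCode`).

For satisfaction, take the process that would output an unknown term, before any step. Its frame is
empty whatever the unknown is, so the observer cannot tell any two ground values apart, and `K`
quantifies over all of them. Hence knowing that the unknown does not solve `run e x = zero` means
that there is no ground solution, that is, program `e` does not halt
(`exists_ground_run_eq_zero_iff`, `sat_haltInput_iff`). The input depends computably on `e`, so
deciding satisfaction would decide halting. -/

theorem Term.subst_eq_self_of_isGround {S : Signature} (s : ℕ → Term S) :
    ∀ M : Term S, M.IsGround → M.subst id s = M
  | .name _, _ => rfl
  | .var _, h => by simp [Term.IsGround, Term.vars] at h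
  | .app f args, h => by
    have hargs : ∀ i, (args i).IsGround := by
      intro i
      refine Finset.subset_empty.1 ((Finset.subset_biUnion_of_mem (fun i => (args i).vars)
        (Finset.mem_univ i)).trans (Finset.subset_empty.2 h))
    simp only [Term.subst, Term.app.injEq, heq_eq_eq, true_and]
    exact funext fun i => subst_eq_self_of_isGround s (args i) (hargs i)

/-! ## A theory whose unary numerals witness halting

The signature has a constant `zero`, a unary `succ` and a binary `run`. The equations are
`run e k = zero`, for the numerals of all `e` and `k` such that the program with number `e`, started
on input `0`, halts within `k` steps. -/

/-- Program number `e`, on input `0`, halts within the bound `k`. -/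
def HaltsWithin (e k : ℕ) : Prop :=
  (Nat.Partrec.Code.evaln k (Denumerable.ofNat Nat.Partrec.Code e) 0).isSome = true

/-- Symbols `zero`, `succ` and `run`, of arities `0`, `1` and `2`. -/
def haltSig : Signature := ⟨3, ![0, 1, 2]⟩

namespace HaltTerm

def zero : Term haltSig := Term.app (0 : Fin 3) Fin.elim0

def succ (M : Term haltSig) : Term haltSig :=
  Term.app (1 : Fin 3) fun _ : Fin 1 => M

def run (M N : Term haltSig) : Term haltSig :=
  Term.app (2 : Fin 3) (![M, N] : Fin 2 → Term haltSig)

def num : ℕ → Term haltSig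
  | 0 => zero
  | k + 1 => succ (num k)

theorem subst_zero (s : ℕ → Term haltSig) : zero.subst id s = zero :=
  congrArg (Term.app (S := haltSig) (0 : Fin 3)) (funext fun i : Fin 0 => i.elim0)

theorem subst_run (s : ℕ → Term haltSig) (M N : Term haltSig) :
    (run M N).subst id s = run (M.subst id s) (N.subst id s) :=
  congrArg (Term.app (S := haltSig) (2 : Fin 3)) <| funext fun i : Fin 2 => by
    fin_cases i <;> rfl

theorem vars_zero : zero.vars = ∅ := rfl

theorem vars_succ (M : Term haltSig) : (succ M).vars = M.vars :=
  (Finset.biUnion_congr rfl fun _ _ => rfl).trans (Finset.singleton_biUnion (a := (0 : Fin 1)))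

theorem names_succ (M : Term haltSig) : (succ M).names = M.names :=
  (Finset.biUnion_congr rfl fun _ _ => rfl).trans (Finset.singleton_biUnion (a := (0 : Fin 1)))

theorem vars_run (M N : Term haltSig) : (run M N).vars = M.vars ∪ N.vars := by
  change (Finset.univ : Finset (Fin 2)).biUnion
    (fun i => ((![M, N] : Fin 2 → Term haltSig) i).vars) = _
  ext; simp

theorem names_run (M N : Term haltSig) : (run M N).names = M.names ∪ N.names := by
  change (Finset.univ : Finset (Fin 2)).biUnion
    (fun i => ((![M, N] : Fin 2 → Term haltSig) i).names) = _
  ext; simp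

theorem vars_num : ∀ k, (num k).vars = ∅
  | 0 => rfl
  | k + 1 => (vars_succ _).trans (vars_num k)

theorem names_num : ∀ k, (num k).names = ∅
  | 0 => rfl
  | k + 1 => (names_succ _).trans (names_num k)

theorem run_injective {M N M' N' : Term haltSig} (h : run M N = run M' N') :
    M = M' ∧ N = N' := by
  have h' : (![M, N] : Fin 2 → Term haltSig) = ![M', N'] := eq_of_heq (Term.app.inj h).2
  exact ⟨congrFun h' 0, congrFun h' 1⟩

end HaltTerm

open HaltTerm

/-- The theory with the equations `run e k = zero` for the `e` that halt within `k`. -/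
def haltTheory : Theory haltSig where
  eqs := {p | ∃ e k, HaltsWithin e k ∧ p = (run (num e) (num k), zero)}
  nameless := by
    rintro _ ⟨e, k, -, rfl⟩
    exact ⟨by simp [names_run, names_num], rfl⟩

/-! ### Normal forms -/

/-- Left-hand sides of the equations. -/
def IsRedex (M : Term haltSig) : Prop := ∃ e k, HaltsWithin e k ∧ M = run (num e) (num k)

open Classical in
/-- Contraction at the root. -/
noncomputable def contract (M : Term haltSig) : Term haltSig := if IsRedex M then zero else M

/-- Innermost normal form. -/
noncomputable def normalForm : Term haltSig → Term haltSig
  | .name n => .name n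
  | .var x => .var x
  | .app f args => contract (.app f fun i => normalForm (args i))

/-- Every redex has `run` at its root. This is why numerals, built from `zero` and `succ` alone, are
already normal. -/
theorem not_isRedex_of_symbol {f : Fin 3} (hf : f ≠ 2) (args) :
    ¬ IsRedex (Term.app (S := haltSig) f args) := by
  rintro ⟨e, k, -, h⟩
  exact hf (Term.app.inj h).1

theorem normalForm_zero : normalForm zero = zero := by
  have h : normalForm zero = contract zero :=
    congrArg (fun a => contract (Term.app (S := haltSig) (0 : Fin 3) a))
      (funext fun i : Fin 0 => i.elim0)
  exact h.trans (if_neg (not_isRedex_of_symbol (by decide) _))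

theorem normalForm_succ (M : Term haltSig) : normalForm (succ M) = succ (normalForm M) :=
  if_neg (not_isRedex_of_symbol (by decide) _)

theorem normalForm_run (M N : Term haltSig) :
    normalForm (run M N) = contract (run (normalForm M) (normalForm N)) :=
  congrArg (fun a => contract (Term.app (S := haltSig) (2 : Fin 3) a)) <|
    funext fun i : Fin 2 => by fin_cases i <;> rfl

theorem normalForm_num : ∀ k, normalForm (num k) = num k
  | 0 => normalForm_zero
  | k + 1 => by rw [num, normalForm_succ, normalForm_num k]

theorem haltTheory_eq_of_isRedex {M : Term haltSig} (h : IsRedex M) : haltTheory.Eq M zero := by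
  obtain ⟨e, k, hek, rfl⟩ := h
  have h := Theory.Eq.inst (T := haltTheory) Term.var
    (show (run (num e) (num k), zero) ∈ haltTheory.eqs from ⟨e, k, hek, rfl⟩)
  rwa [Term.subst_eq_self_of_isGround _ _ (by simp [Term.IsGround, vars_run, vars_num]),
    Term.subst_eq_self_of_isGround _ _ vars_zero] at h

theorem haltTheory_eq_contract (M : Term haltSig) : haltTheory.Eq M (contract M) := by
  unfold contract
  split_ifs with h
  exacts [haltTheory_eq_of_isRedex h, .refl M]

theorem haltTheory_eq_normalForm : ∀ M : Term haltSig, haltTheory.Eq M (normalForm M)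
  | .name _ => .refl _
  | .var _ => .refl _
  | .app f args =>
    (Theory.Eq.congr f fun i => haltTheory_eq_normalForm (args i)).trans (haltTheory_eq_contract _)

/-- No confluence argument is needed: the normal form of an application is a function of its symbol
and the normal forms of its arguments, so having equal normal forms is a congruence. It remains to
check the equations, whose arguments are normal numerals. -/
theorem normalForm_eq_of_eq {M N : Term haltSig} (h : haltTheory.Eq M N) :
    normalForm M = normalForm N := by
  induction h with
  | @inst M N s h =>
    obtain ⟨e, k, hek, h⟩ := h
    obtain ⟨rfl, rfl⟩ := Prod.mk.inj h
    -- Both sides are ground, so the only substitution instance of an equation is the equation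
    -- itself.
    rw [Term.subst_eq_self_of_isGround _ _ (by simp [Term.IsGround, vars_run, vars_num]),
      Term.subst_eq_self_of_isGround _ _ vars_zero, normalForm_run, normalForm_num,
      normalForm_num, normalForm_zero, contract, if_pos ⟨e, k, hek, rfl⟩]
  | refl => rfl
  | symm _ ih => exact ih.symm
  | trans _ _ ih₁ ih₂ => exact ih₁.trans ih₂
  | congr f _ ih => simp only [normalForm, funext ih]

theorem haltTheory_eq_iff {M N : Term haltSig} :
    haltTheory.Eq M N ↔ normalForm M = normalForm N :=
  ⟨normalForm_eq_of_eq, fun h =>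
    (haltTheory_eq_normalForm M).trans (h ▸ (haltTheory_eq_normalForm N).symm)⟩

/-- A program halts iff some ground term makes the corresponding equation true. -/
theorem exists_ground_run_eq_zero_iff (e : ℕ) :
    (∃ M : Term haltSig, M.IsGround ∧ haltTheory.Eq (run (num e) M) zero) ↔
      ∃ k, HaltsWithin e k := by
  constructor
  · rintro ⟨M, -, h⟩
    rw [haltTheory_eq_iff, normalForm_run, normalForm_num, normalForm_zero, contract] at h
    -- The term `M` may be arbitrary, but its normal form must be a numeral: without a contraction
    -- at the root, the normal form would still start with `run` and could not be `zero`.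
    split_ifs at h with hr
    · obtain ⟨e', k, hk, h'⟩ := hr
      obtain ⟨he, -⟩ := run_injective h'
      have num_injective : Function.Injective num := by
        intro a
        induction a with
        | zero =>
          rintro (_ | b) h
          · rfl
          · exact absurd (Term.app.inj h).1 (by decide : (0 : Fin 3) ≠ 1)
        | succ a ih =>
          rintro (_ | b) h
          · exact absurd (Term.app.inj h).1 (by decide : (1 : Fin 3) ≠ 0)
          · exact congrArg _ (ih (congrFun (eq_of_heq (Term.app.inj h).2) (0 : Fin 1)))
      exact ⟨k, num_injective he ▸ hk⟩
    · exact absurd (Term.app.inj h).1 (by decide : (2 : Fin 3) ≠ 0)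
  · rintro ⟨k, hk⟩
    exact ⟨num k, vars_num k, haltTheory_eq_of_isRedex ⟨e, k, hk, rfl⟩⟩

/-! ### Decidability of the word problem -/

/-- The code of `succ M` from the code of `M`. -/
def succCode (m : ℕ) : ℕ := Nat.pair 2 (Nat.pair 1 (Encodable.encode [m]))

/-- The code of `run M N` from the codes of `M` and `N`. -/
def runCode (m n : ℕ) : ℕ := Nat.pair 2 (Nat.pair 2 (Encodable.encode [m, n]))

/-- The code of the numeral of `k`. -/
def numCode (k : ℕ) : ℕ := Nat.rec zero.code (fun _ m => succCode m) k

theorem code_run (M N : Term haltSig) : (run M N).code = runCode M.code N.code := rfl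

theorem code_num : ∀ k, (num k).code = numCode k
  | 0 => rfl
  | k + 1 => congrArg succCode (code_num k)

/-- A nonempty list is encoded as the successor of a pair, which makes the inequality strict. It
bounds the search for redexes and puts the codes of subterms within reach of course-of-values
recursion. -/
theorem lt_encode_of_mem : ∀ {l : List ℕ} {a : ℕ}, a ∈ l → a < Encodable.encode l
  | b :: l, a, h => by
    rw [Encodable.encode_list_cons, Nat.lt_succ_iff]
    rcases List.mem_cons.1 h with rfl | h
    · exact Nat.left_le_pair _ _
    · exact (lt_encode_of_mem h).le.trans (Nat.right_le_pair _ _)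

theorem lt_numCode : ∀ k, k < numCode k
  | 0 => by decide
  | k + 1 => (Nat.succ_le_of_lt (lt_numCode k)).trans_lt <|
      (lt_encode_of_mem (List.mem_singleton_self _)).trans_le <|
        (Nat.right_le_pair _ _).trans (Nat.right_le_pair _ _)

theorem left_lt_runCode (m n : ℕ) : m < runCode m n :=
  (lt_encode_of_mem (by simp)).trans_le <| (Nat.right_le_pair _ _).trans (Nat.right_le_pair _ _)

theorem right_lt_runCode (m n : ℕ) : n < runCode m n :=
  (lt_encode_of_mem (by simp)).trans_le <| (Nat.right_le_pair _ _).trans (Nat.right_le_pair _ _)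

/-- `n` is the code of a redex, with bounded quantifiers. -/
def IsRedexCode (n : ℕ) : Prop :=
  ∃ e < n, ∃ k < n, HaltsWithin e k ∧ n = runCode (numCode e) (numCode k)

/-- The bounds on `e` and `k` lose nothing: a number is smaller than the code of its numeral, which
is smaller than the code of any `run` term containing it as an argument. -/
theorem isRedexCode_code (M : Term haltSig) : IsRedexCode M.code ↔ IsRedex M := by
  constructor
  · rintro ⟨e, -, k, -, hek, h⟩
    rw [← code_num, ← code_num, ← code_run] at h
    exact ⟨e, k, hek, Term.code_injective h⟩
  · rintro ⟨e, k, hek, rfl⟩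
    have h : (run (num e) (num k)).code = runCode (numCode e) (numCode k) := by
      rw [code_run, code_num, code_num]
    exact ⟨e, h ▸ (lt_numCode e).trans (left_lt_runCode _ _),
      k, h ▸ (lt_numCode k).trans (right_lt_runCode _ _), hek, h⟩

open Classical in
/-- Contraction at the root, on codes. -/
noncomputable def contractCode (n : ℕ) : ℕ := if IsRedexCode n then zero.code else n

theorem contractCode_code (M : Term haltSig) : contractCode M.code = (contract M).code := by
  by_cases h : IsRedex M
  · rw [contractCode, contract, if_pos h, if_pos ((isRedexCode_code M).2 h)]
  · rw [contractCode, contract, if_neg h, if_neg (mt (isRedexCode_code M).1 h)]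

/-- One step of the computation of normal forms on codes, from the table of the values at all
smaller arguments. -/
noncomputable def normalCodeStep (t : List ℕ) : ℕ :=
  -- The length of the table is the argument being processed. Tag `2` marks applications; the next
  -- two components are the symbol and the encoded list of argument codes. The default `0` is never
  -- used on codes of terms, since arguments have smaller codes.
  if t.length.unpair.1 = 2 then
    contractCode (Nat.pair 2 (Nat.pair t.length.unpair.2.unpair.1 (Encodable.encode
      ((Denumerable.ofNat (List ℕ) t.length.unpair.2.unpair.2).map fun m => t.getD m 0))))
  else t.length

/-- The normal form, on codes. -/
noncomputable def normalCode (n : ℕ) : ℕ :=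
  normalCodeStep ((List.range n).attach.map fun m => normalCode m.1)
decreasing_by exact List.mem_range.1 m.2

theorem normalCode_eq (n : ℕ) :
    normalCode n = normalCodeStep ((List.range n).map normalCode) := by
  rw [normalCode]
  simp only [List.map_attach_eq_pmap, List.pmap_eq_map]

theorem normalCode_code : ∀ M : Term haltSig, normalCode M.code = (normalForm M).code
  | .name n => by simp [normalCode_eq, normalCodeStep, Term.code, normalForm]
  | .var n => by simp [normalCode_eq, normalCodeStep, Term.code, normalForm]
  | .app f args => by
    rw [normalForm, ← contractCode_code, normalCode_eq, normalCodeStep]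
    simp only [List.length_map, List.length_range, Term.code, Nat.unpair_pair, if_true,
      Denumerable.ofNat_encode]
    congr 4
    rw [List.map_ofFn]
    congr 1
    funext i
    -- This places the table lookup in range, so that it returns the value of the recursion and not
    -- the default.
    have hlt : (args i).code < (Term.app f args).code :=
      (lt_encode_of_mem (by simp)).trans_le <|
        (Nat.right_le_pair _ _).trans (Nat.right_le_pair _ _)
    rw [Term.code] at hlt
    simp [hlt, normalCode_code (args i)]

/-! ### Primitive recursiveness of normalisation on codes -/

theorem primrecRel_haltsWithin : PrimrecRel HaltsWithin :=
  Primrec.eq.comp (Primrec.option_isSome.comp <| Nat.Partrec.Code.primrec_evaln.comp <|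
    ((Primrec.snd.pair ((Primrec.ofNat _).comp Primrec.fst)).pair (Primrec.const 0)))
    (Primrec.const true)

theorem primrec_succCode : Primrec succCode :=
  Primrec₂.natPair.comp (.const 2) <| Primrec₂.natPair.comp (.const 1) <|
    Primrec.encode.comp <| Primrec.list_cons.comp .id (.const [])

theorem primrec_runCode : Primrec₂ runCode :=
  Primrec₂.natPair.comp (.const 2) <| Primrec₂.natPair.comp (.const 2) <|
    Primrec.encode.comp <| Primrec.list_cons.comp .fst <|
      Primrec.list_cons.comp .snd (.const [])

theorem primrec_numCode : Primrec numCode :=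
  Primrec.nat_rec₁ _ (primrec_succCode.comp .snd)

theorem primrecPred_isRedexCode : PrimrecPred IsRedexCode := by
  have hR : PrimrecRel fun (k : ℕ) (p : ℕ × ℕ) =>
      HaltsWithin p.1 k ∧ p.2 = runCode (numCode p.1) (numCode k) :=
    PrimrecPred.and (primrecRel_haltsWithin.comp (Primrec.fst.comp .snd) .fst)
      (Primrec.eq.comp (Primrec.snd.comp .snd)
        (primrec_runCode.comp (primrec_numCode.comp (Primrec.fst.comp .snd))
          (primrec_numCode.comp .fst)))
  -- The inner bounded quantifier still depends on both `e` and `n`, so it is treated as a search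
  -- through `List.range n` with the pair as parameter.
  have hR' : PrimrecRel fun e n : ℕ => ∃ k < n, HaltsWithin e k ∧
      n = runCode (numCode e) (numCode k) :=
    (PrimrecRel.comp (R := fun (L : List ℕ) (p : ℕ × ℕ) => ∃ k ∈ L, HaltsWithin p.1 k ∧
      p.2 = runCode (numCode p.1) (numCode k)) hR.exists_mem_list
      (Primrec.list_range.comp .snd) .id).of_eq (by simp)
  exact hR'.exists_lt.comp Primrec.id Primrec.id

theorem primrec_contractCode : Primrec contractCode := by
  classical
  exact (Primrec.ite primrecPred_isRedexCode (.const zero.code) .id).of_eq fun n => by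
    simp [contractCode]

theorem primrec_normalCodeStep : Primrec normalCodeStep := by
  have hlen : Primrec fun t : List ℕ => t.length.unpair := Primrec.unpair.comp .list_length
  have hargs : Primrec fun t : List ℕ => t.length.unpair.2.unpair :=
    Primrec.unpair.comp (Primrec.snd.comp hlen)
  refine Primrec.ite (Primrec.eq.comp (Primrec.fst.comp hlen) (.const 2)) ?_ .list_length
  refine primrec_contractCode.comp <| Primrec₂.natPair.comp (.const 2) <|
    Primrec₂.natPair.comp (Primrec.fst.comp hargs) <| Primrec.encode.comp ?_
  exact Primrec.list_map ((Primrec.ofNat _).comp (Primrec.snd.comp hargs)) (Primrec.list_getD 0)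

theorem primrec_normalCode : Primrec normalCode := by
  -- Strong recursion is available with a parameter; the unit type serves as a dummy one.
  have h : Primrec₂ fun (_ : Unit) n => normalCode n :=
    Primrec.nat_strong_rec _
      (g := fun _ t => some (normalCodeStep t))
      (Primrec.option_some.comp (primrec_normalCodeStep.comp .snd))
      fun _ n => congrArg some (normalCode_eq n).symm
  exact h.comp (.const ()) .id

theorem haltTheory_wordProblemDecidable : haltTheory.WordProblemDecidable := by
  have hp : PrimrecPred fun p : ℕ × ℕ => normalCode p.1 = normalCode p.2 :=
    Primrec.eq.comp (primrec_normalCode.comp .fst) (primrec_normalCode.comp .snd)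
  classical
  refine ⟨_, hp.decide.to_comp.partrec, fun p _ => ⟨_, Part.mem_some _, ?_⟩⟩
  simp [normalCode_code, Term.code_injective.eq_iff, haltTheory_eq_iff]

/-! ## Undecidability of the satisfaction problem -/

/-- The process that outputs its unknown `x₀` on a public channel. -/
def outputUnknown : Proc haltSig := out (.name 0) (.var 0) nil

theorem isAssignment_outputUnknown_iff (ρ : Subst haltSig) :
    IsAssignment outputUnknown ρ ↔ ∃ M : Term haltSig, M.IsGround ∧ ρ = [(0, M)] := by
  have hfv : outputUnknown.fv \ outputUnknown.dom = {0} := by decide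
  constructor
  · rintro ⟨hnd, hkeys, hg⟩
    rw [hfv] at hkeys
    have hlen : ρ.length = 1 := by
      have h := List.toFinset_card_of_nodup hnd
      rw [hkeys] at h
      simpa using h.symm
    obtain ⟨⟨x, M⟩, rfl⟩ := List.length_eq_one_iff.1 hlen
    have hx : x = 0 := by simpa using hkeys
    subst hx
    exact ⟨M, hg (0, M) (by simp), rfl⟩
  · rintro ⟨M, hM, rfl⟩
    exact ⟨by simp, by simp [hfv], by simpa using hM⟩

theorem assign_outputUnknown (M : Term haltSig) :
    outputUnknown.assign [(0, M)] = out (.name 0) M nil := by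
  simp [outputUnknown, Proc.assign, Proc.subst, Term.subst, Subst.toFun]

theorem isTraceFrom_out_nil {M : Term haltSig} (hM : M.IsGround) :
    IsTraceFrom haltTheory (out (.name 0) M nil) [] := by
  refine ⟨trivial, ?_⟩
  have hM : M.vars = ∅ := hM
  simp [Proc.IsClosed, Proc.fv, Proc.dom, Term.vars, hM]

/-- It is known that the unknown `x₀` does not witness that program number `e` halts. -/
def knowNotWitness (e : ℕ) : Formula haltSig :=
  .know (.neg (.eq (run (num e) (.var 0)) zero))

/-- For ground `M` and `N`, equality in the empty frame is equality in the theory. -/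
theorem eqIn_nil_iff {S : Signature} {T : Theory S} {M N : Term S} (hM : M.IsGround)
    (hN : N.IsGround) : EqIn T nil M N ↔ T.Eq M N := by
  constructor
  · rintro ⟨-, ns, s, -, -, h⟩
    rwa [Term.subst_eq_self_of_isGround _ _ hM, Term.subst_eq_self_of_isGround _ _ hN] at h
  · intro h
    have hM' : M.vars = ∅ := hM
    have hN' : N.vars = ∅ := hN
    refine ⟨by simp [hM', hN'], [], [], .refl trivial, by simp, ?_⟩
    rwa [Term.subst_eq_self_of_isGround _ _ hM, Term.subst_eq_self_of_isGround _ _ hN]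

/-- The input of the satisfaction problem for program number `e`: the unknown is `zero` and no step
has been taken. -/
def haltInput (e : ℕ) : SatInput haltSig where
  proc := outputUnknown
  asg := [(0, zero)]
  trace := ⟨out (.name 0) zero nil, []⟩
  idx := 0
  formula := knowNotWitness e

theorem haltInput_valid (e : ℕ) : (haltInput e).Valid haltTheory := by
  refine ⟨trivial, ⟨by simp [haltInput, outputUnknown, Proc.bn],
    by simp [haltInput, outputUnknown, Proc.bn], by simp [haltInput, outputUnknown, Proc.rv],
    by simp [haltInput, outputUnknown, Proc.rv]⟩,
    (isAssignment_outputUnknown_iff _).2 ⟨zero, vars_zero, rfl⟩,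
    ⟨(assign_outputUnknown zero).symm, isTraceFrom_out_nil vars_zero⟩, ?_, Nat.zero_le _, ?_⟩
  · intro j hj
    obtain rfl : j = 0 := Nat.le_zero.1 hj
    simp [haltInput, Trace.proc, Proc.Distinct, Proc.bn, Proc.rv]
  · have h : (haltInput e).formula.fv = {0} := by
      simp [haltInput, knowNotWitness, Formula.fv, vars_run, vars_num, vars_zero, Term.vars]
    rw [h]
    exact Finset.subset_union_left.trans'
      (by decide : {0} ⊆ outputUnknown.fv \ outputUnknown.dom)

/-- Only the process at index `0` matters, so the continuation `l` is arbitrary. Its frame is `nil`,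
and substituting the assignment makes both sides of the equation ground, so `eqIn_nil_iff` applies.
-/
theorem sat_neg_eq_iff {e : ℕ} {M : Term haltSig} (hM : M.IsGround)
    (l : List (Action haltSig × Proc haltSig)) :
    Sat haltTheory outputUnknown (.neg (.eq (run (num e) (.var 0)) zero)) [(0, M)]
      ⟨out (.name 0) M nil, l⟩ 0 ↔ ¬ haltTheory.Eq (run (num e) M) zero := by
  have hM' : M.vars = ∅ := hM
  have hs : (run (num e) (.var 0)).subst id (Subst.toFun [(0, M)]) = run (num e) M := by
    rw [subst_run, Term.subst_eq_self_of_isGround _ _ (vars_num e)]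
    simp [Term.subst, Subst.toFun]
  simp only [Sat, Trace.proc, List.getD_cons_zero, Proc.frame]
  rw [hs, subst_zero, eqIn_nil_iff _ vars_zero]
  simp [Term.IsGround, vars_run, vars_num, hM']

/-- At index `0` the observed prefix is a single process with empty frame, so every assignment of a
ground term is indistinguishable from the actual one. A ground solution thus gives a possible trace,
the one without steps, that refutes the knowledge; conversely every competing trace starts from some
ground `M`. -/
theorem sat_haltInput_iff (e : ℕ) :
    Sat haltTheory (haltInput e).proc (haltInput e).formula (haltInput e).asg (haltInput e).trace
      (haltInput e).idx ↔ ¬ ∃ k, HaltsWithin e k := by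
  rw [← exists_ground_run_eq_zero_iff]
  change (∀ (ρ' : Subst haltSig) (tr' : Trace haltSig), _ → _ → _ → _ → _) ↔ _
  constructor
  · rintro h ⟨M, hM, hE⟩
    refine (sat_neg_eq_iff hM []).1 (h [(0, M)] ⟨out (.name 0) M nil, []⟩
      ((isAssignment_outputUnknown_iff _).2 ⟨M, hM, rfl⟩)
      ⟨(assign_outputUnknown M).symm, isTraceFrom_out_nil hM⟩ (Nat.zero_le _)
      ⟨rfl, rfl, fun i hi => ?_⟩) hE
    obtain rfl : i = 0 := Nat.le_zero.1 hi
    -- Both frames reduce to `nil`, since the output prefix hides its message.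
    exact ⟨rfl, fun _ _ => Iff.rfl⟩
  · rintro h ρ' ⟨B, l⟩ hρ ⟨hB, -⟩ - -
    obtain ⟨M, hM, rfl⟩ := (isAssignment_outputUnknown_iff _).1 hρ
    obtain rfl : B = out (.name 0) M nil := hB.trans (assign_outputUnknown M)
    exact (sat_neg_eq_iff hM l).2 fun hE => h ⟨M, hM, hE⟩

/-! ### Reduction from the halting problem -/

theorem computable_haltInput_code : Computable fun e => (haltInput e).code := by
  have hφ : Primrec fun e => (knowNotWitness e).code := by
    have h : Primrec fun e => Nat.pair 7 (Nat.pair 4 (Nat.pair 1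
        (Nat.pair (runCode (numCode e) (Term.var (S := haltSig) 0).code) zero.code))) :=
      Primrec₂.natPair.comp (.const 7) <| Primrec₂.natPair.comp (.const 4) <|
        Primrec₂.natPair.comp (.const 1) <| Primrec₂.natPair.comp
          (primrec_runCode.comp primrec_numCode (.const _)) (.const _)
    exact h.of_eq fun e => by simp [knowNotWitness, Formula.code, code_run, code_num]
  -- Only the formula varies with `e`; the other five components of the code are constant.
  exact ((Primrec.const _).pair <| (Primrec.const _).pair <| (Primrec.const _).pair <|
    (Primrec.const _).pair <| (Primrec.const _).pair hφ).to_comp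

theorem exists_haltsWithin_iff (c : Nat.Partrec.Code) :
    (∃ k, HaltsWithin (Encodable.encode c) k) ↔ (c.eval 0).Dom := by
  simp only [HaltsWithin, Denumerable.ofNat_encode, Option.isSome_iff_exists, Part.dom_iff_mem,
    Nat.Partrec.Code.evaln_complete, Option.mem_def]
  exact exists_comm

theorem haltTheory_not_satDecidable : ¬ haltTheory.SatDecidable := by
  rintro ⟨f, hf, h⟩
  -- A decision procedure may diverge on invalid codes, but these inputs are all valid, so its
  -- answers on them form a total computable function.
  choose b hb hb' using fun e => h (haltInput e) (haltInput_valid e)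
  have hcomp : Computable b :=
    (hf.comp computable_haltInput_code).of_eq_tot fun e => hb e
  refine ComputablePred.halting_problem 0 (ComputablePred.computable_iff.2
    -- The answer is negated because the formula holds exactly for the programs that do not halt.
    ⟨fun c => !b (Encodable.encode c),
      Primrec.not.to_comp.comp (hcomp.comp Computable.encode), funext fun c => propext ?_⟩)
  rw [← exists_haltsWithin_iff, ← not_iff_not, ← sat_haltInput_iff]
  refine (hb' (Encodable.encode c)).symm.trans ?_
  simp

end AppliedPi

theorem mainTheorem8 :
    ∃ (S : AppliedPi.Signature) (T : AppliedPi.Theory S),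
      T.WordProblemDecidable ∧ ¬ T.SatDecidable :=
  ⟨_, _, AppliedPi.haltTheory_wordProblemDecidable, AppliedPi.haltTheory_not_satDecidable⟩
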